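/- For a form $f\in\mathbb{C}[x_0,\dots,x_n]$ of degree $d\ge 1$, a \emph{Waring decomposition} of $f$ is an expression $f=\ell_1^d+\dots+\ell_s^d$ with linear forms $\ell_i$; the minimal length $s$ of such an expression is the \emph{(Waring) rank} $\mathrm{rk}(f)$, and a decomposition of this length is called \emph{minimal}. With $r=\mathrm{rk}(f)$, the \emph{Waring locus} of $f$ is $$\mathcal{W}_f=\{[\ell] : \ell\neq 0 \text{ a linear form such that there are linear forms } \ell_2,\dots,\ell_r \text{ with } f\in\langle \ell^d,\ell_2^d,\dots,\ell_r^d\rangle\},$$ a subset of the projective space of linear forms, which is identified with $\mathbb{P}^n$ by sending $[a_0x_0+\dots+a_nx_n]$ to $(a_0:\dots:a_n)$. The same notions are used for binary forms in $x_1,x_2$. \textbf{Lemma.} Let $d\ge 1$, let $g\in\mathbb{C}[x_1,x_2]$ be homogeneous of degree $d$, and suppose that $f=x_0^d+g(x_1,x_2)\in\mathbb{C}[x_0,x_1,x_2]$ has rank at least $4$. Then $\mathrm{rk}(f)=\mathrm{rk}(g)+1$ and $$\mathcal{W}_f=\{(1:0:0)\}\cup\mathcal{W}_g,$$ where $\mathcal{W}_g$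 is regarded as a subset of $\mathbb{P}^2$ through the inclusion of the linear forms in $x_1,x_2$ into those in $x_0,x_1,x_2$. Moreover, up to the order of the summands, the minimal Waring decompositions of $f$ are exactly the expressions $f=(\zeta x_0)^d+\ell_1^d+\dots+\ell_r^d$ with $\zeta\in\mathbb{C}$, $\zeta^d=1$, $r=\mathrm{rk}(g)$, and $g=\ell_1^d+\dots+\ell_r^d$ a minimal Waring decomposition of $g$ with linear forms $\ell_i\in\mathbb{C}[x_1,x_2]$. -/

import Mathlib

open scoped LinearAlgebra.Projectivization

noncomputable section

/-- The space `S_1` of linear forms in the variables indexed by `σ`, with complex coefficients. -/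
abbrev LinForm (σ : Type*) := MvPolynomial.homogeneousSubmodule σ ℂ 1

/-- `f = ℓ_1 ^ d + ... + ℓ_s ^ d`, where `ℓ_1, ..., ℓ_s` are the members of `L`, which are listed
without an order and with repetitions allowed. -/
def IsWaringDecomposition {σ : Type*} (d : ℕ) (f : MvPolynomial σ ℂ)
    (L : Multiset (LinForm σ)) : Prop :=
  f = (L.map fun ℓ => (ℓ : MvPolynomial σ ℂ) ^ d).sum

/-- The Waring rank of a form `f` of degree `d`: the minimal length of a Waring decomposition. -/
def waringRank {σ : Type*} (d : ℕ) (f : MvPolynomial σ ℂ) : ℕ :=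
  sInf {s : ℕ | ∃ L : Multiset (LinForm σ), IsWaringDecomposition d f L ∧ Multiset.card L = s}

/-- A Waring decomposition of minimal length. -/
def IsMinimalWaringDecomposition {σ : Type*} (d : ℕ) (f : MvPolynomial σ ℂ)
    (L : Multiset (LinForm σ)) : Prop :=
  IsWaringDecomposition d f L ∧ Multiset.card L = waringRank d f

/-- The Waring locus of a form `f` of degree `d` and rank `r`: the points `[ℓ]` of the projective
space of linear forms for which there are linear forms `ℓ_2, ..., ℓ_r` (the members of `M`)
such that `f` lies in the linear span of `ℓ ^ d, ℓ_2 ^ d, ..., ℓ_r ^ d`. -/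
def waringLocus {σ : Type*} (d : ℕ) (f : MvPolynomial σ ℂ) : Set (ℙ ℂ (LinForm σ)) :=
  {P | ∃ (ℓ : LinForm σ) (hℓ : ℓ ≠ 0), P = Projectivization.mk ℂ ℓ hℓ ∧
    ∃ M : Multiset (LinForm σ), Multiset.card M + 1 = waringRank d f ∧
      f ∈ Submodule.span ℂ
        ((fun m : LinForm σ => (m : MvPolynomial σ ℂ) ^ d) '' {m | m ∈ ℓ ::ₘ M})}

/-- A variable, as a linear form. -/
def varForm {σ : Type*} (i : σ) : LinForm σ :=
  ⟨MvPolynomial.X i, MvPolynomial.isHomogeneous_X ℂ i⟩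

theorem varForm_ne_zero {σ : Type*} (i : σ) : varForm i ≠ 0 := fun h =>
  MvPolynomial.X_ne_zero (R := ℂ) i (congrArg Subtype.val h)

/-- The inclusion of the binary linear forms into the ternary ones; the two binary variables are
`x_1, x_2` and the ternary variables are `x_0, x_1, x_2`. -/
def binaryIncl : LinForm (Fin 2) →ₗ[ℂ] LinForm (Fin 3) :=
  (MvPolynomial.rename (R := ℂ) (Fin.succ : Fin 2 → Fin 3)).toLinearMap.restrict
    fun _ h => MvPolynomial.IsHomogeneous.rename_isHomogeneous h

theorem binaryIncl_injective : Function.Injective binaryIncl := fun _ _ h =>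
  Subtype.ext (MvPolynomial.rename_injective _ (Fin.succ_injective 2) (congrArg Subtype.val h))

end

/-! Split a decomposition of `f` of length at most `rk(g) + 1` into the forms `A` involving `x_0`
and the binary forms `B`, and let `h` be `g` minus the power sum of `B`. If `h = 0`, then `B` has at
least `rk(g)` members, so `A` is a single form whose power is `x_0 ^ d`, hence `ζ x_0`. If `h ≠ 0`,
then `h` is the power sum of `A` minus `x_0 ^ d`, i.e. a sum of `|A| + 1` powers of forms all
involving `x_0`. By `waringRank_add_three_le` this forces `rk(h) + 3 ≤ |A| + 1`, and adjoining `B`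
to a minimal decomposition of `h` gives one of `g` that is too short.

That lemma differentiates along `x_0`, which gives a relation with nonzero coefficients between
`(d-1)`-th powers. By apolarity (`sum_mul_prod_eq_zero`) no point can then be separated from the
others by `d - 1` hyperplanes. For at most `d + 2` points this leaves only collinear ones
(`exists_isSeparatedBy_or_collinear`), where projection gives `rk(h) ≤ 1`; more points are harmless
because a binary form has rank at most `d`. -/

noncomputable section

open MvPolynomial

/-! ### Power sums, directional derivatives and apolarity -/

section LinearForms

variable {σ : Type*}

/-- The sum of the `d`-th powers of the members of a multiset of linear forms. -/
def powSum (d : ℕ) (L : Multiset (LinForm σ)) : MvPolynomial σ ℂ :=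
  (L.map fun ℓ : LinForm σ => (ℓ : MvPolynomial σ ℂ) ^ d).sum

theorem isWaringDecomposition_iff {d : ℕ} {f : MvPolynomial σ ℂ} {L : Multiset (LinForm σ)} :
    IsWaringDecomposition d f L ↔ f = powSum d L := by
  simp [IsWaringDecomposition, powSum, Multiset.pure_def, Multiset.bind_def,
    Multiset.bind_singleton, Multiset.map_map]

@[simp] theorem powSum_zero (d : ℕ) : powSum d (0 : Multiset (LinForm σ)) = 0 := by
  simp [powSum]

@[simp] theorem powSum_cons (d : ℕ) (ℓ : LinForm σ) (L : Multiset (LinForm σ)) :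
    powSum d (ℓ ::ₘ L) = (ℓ : MvPolynomial σ ℂ) ^ d + powSum d L := by
  simp [powSum]

@[simp] theorem powSum_singleton (d : ℕ) (ℓ : LinForm σ) :
    powSum d {ℓ} = (ℓ : MvPolynomial σ ℂ) ^ d := by
  simp [powSum]

@[simp] theorem powSum_add (d : ℕ) (L M : Multiset (LinForm σ)) :
    powSum d (L + M) = powSum d L + powSum d M := by
  simp [powSum]

theorem isHomogeneous_powSum (d : ℕ) (L : Multiset (LinForm σ)) :
    (powSum d L).IsHomogeneous d := by
  rw [powSum, ← mem_homogeneousSubmodule]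
  refine multiset_sum_mem _ fun p hp => ?_
  obtain ⟨ℓ, -, rfl⟩ := Multiset.mem_map.1 hp
  simpa using ((mem_homogeneousSubmodule 1 (ℓ : MvPolynomial σ ℂ)).1 ℓ.2).pow d

theorem linForm_induction {p : LinForm σ → Prop} (var : ∀ i, p (varForm i))
    (zero : p 0) (add : ∀ ℓ m, p ℓ → p m → p (ℓ + m)) (smul : ∀ (c : ℂ) ℓ, p ℓ → p (c • ℓ))
    (ℓ : LinForm σ) : p ℓ := by
  obtain ⟨q, hq⟩ := ℓ
  have hq' : q ∈ Submodule.span ℂ (Set.range (X : σ → MvPolynomial σ ℂ)) := by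
    rwa [← homogeneousSubmodule_one_eq_span_X]
  have key : ∃ h : q ∈ homogeneousSubmodule σ ℂ 1, p ⟨q, h⟩ := by
    induction hq' using Submodule.span_induction with
    | mem x hx => obtain ⟨i, rfl⟩ := hx; exact ⟨_, var i⟩
    | zero => exact ⟨_, zero⟩
    | add x y hx hy ihx ihy =>
      rw [← homogeneousSubmodule_one_eq_span_X] at hx hy
      obtain ⟨h1, p1⟩ := ihx hx
      obtain ⟨h2, p2⟩ := ihy hy
      exact ⟨_, add _ _ p1 p2⟩
    | smul c x hx ihx =>
      rw [← homogeneousSubmodule_one_eq_span_X] at hx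
      obtain ⟨h1, p1⟩ := ihx hx
      exact ⟨_, smul c _ p1⟩
  exact key.2

/-- Evaluation of linear forms at a point. -/
def evalForm (v : σ → ℂ) : LinForm σ →ₗ[ℂ] ℂ :=
  (aeval v).toLinearMap ∘ₗ (homogeneousSubmodule σ ℂ 1).subtype

theorem evalForm_apply (v : σ → ℂ) (ℓ : LinForm σ) :
    evalForm v ℓ = eval v (ℓ : MvPolynomial σ ℂ) := by
  simp [evalForm, aeval_eq_eval]

@[simp] theorem coe_varForm (i : σ) : (varForm i : MvPolynomial σ ℂ) = X i := rfl

@[simp] theorem evalForm_varForm (v : σ → ℂ) (i : σ) : evalForm v (varForm i) = v i := by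
  simp [evalForm_apply]

theorem exists_evalForm_eq (φ : Module.Dual ℂ (LinForm σ)) : ∃ v, φ = evalForm v := by
  refine ⟨fun i => φ (varForm i), LinearMap.ext fun ℓ => ?_⟩
  induction ℓ using linForm_induction with
  | var i => simp
  | zero => simp
  | add ℓ m h1 h2 => simp [h1, h2]
  | smul c ℓ h => simp [h]

/-- The derivative in the direction `v`. -/
def dirDeriv (v : σ → ℂ) : Derivation ℂ (MvPolynomial σ ℂ) (MvPolynomial σ ℂ) :=
  mkDerivation ℂ fun i => C (v i)

theorem dirDeriv_linForm (v : σ → ℂ) (ℓ : LinForm σ) :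
    dirDeriv v (ℓ : MvPolynomial σ ℂ) = C (evalForm v ℓ) := by
  induction ℓ using linForm_induction with
  | var i => simp [dirDeriv, mkDerivation_X]
  | zero => simp
  | add ℓ m h1 h2 => simp [h1, h2]
  | smul c ℓ h => simp [h, smul_eq_C_mul]

theorem dirDeriv_pow (v : σ → ℂ) (ℓ : LinForm σ) (k : ℕ) :
    dirDeriv v ((ℓ : MvPolynomial σ ℂ) ^ (k + 1)) =
      C ((k + 1) * evalForm v ℓ) * (ℓ : MvPolynomial σ ℂ) ^ k := by
  rw [Derivation.leibniz_pow, dirDeriv_linForm]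
  simp only [Nat.add_sub_cancel, smul_eq_mul, nsmul_eq_mul, map_mul, map_add, map_natCast, map_one]
  push_cast
  ring

/-- A linear relation between `k`-th powers of linear forms holds for all products of `k` linear
functionals. -/
theorem sum_mul_prod_eq_zero (S : Finset (LinForm σ)) (Φ : List (Module.Dual ℂ (LinForm σ)))
    (c : LinForm σ → ℂ)
    (h : ∑ ℓ ∈ S, C (c ℓ) * (ℓ : MvPolynomial σ ℂ) ^ Φ.length = 0) :
    ∑ ℓ ∈ S, c ℓ * (Φ.map fun φ => φ ℓ).prod = 0 := by
  induction Φ generalizing c with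
  | nil =>
    have h' : C (∑ ℓ ∈ S, c ℓ) = (0 : MvPolynomial σ ℂ) := by rw [map_sum]; simpa using h
    simpa only [List.map_nil, List.prod_nil, mul_one] using C_eq_zero.1 h'
  | cons φ Φ ih =>
    obtain ⟨v, rfl⟩ := exists_evalForm_eq φ
    -- Differentiating along `v` lowers the exponent by one and moves the factor `evalForm v ℓ` into
    -- the coefficients.
    have h1 : C ((Φ.length : ℂ) + 1) *
        ∑ ℓ ∈ S, C (c ℓ * evalForm v ℓ) * (ℓ : MvPolynomial σ ℂ) ^ Φ.length = 0 := by
      have h2 := congrArg (dirDeriv v) h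
      rw [map_sum, map_zero] at h2
      rw [← h2, Finset.mul_sum]
      refine Finset.sum_congr rfl fun ℓ _ => ?_
      rw [← smul_eq_C_mul _ (c ℓ), Derivation.map_smul, List.length_cons, dirDeriv_pow, smul_eq_C_mul]
      simp only [map_mul]
      ring
    have h3 : (C ((Φ.length : ℂ) + 1) : MvPolynomial σ ℂ) ≠ 0 := by
      rw [Ne, C_eq_zero]
      exact Nat.cast_add_one_ne_zero _
    have h4 := ih _ ((mul_eq_zero.1 h1).resolve_left h3)
    rw [← h4]
    refine Finset.sum_congr rfl fun ℓ _ => ?_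
    simp only [List.map_cons, List.prod_cons]
    ring

end LinearForms

/-! ### Binary forms of degree `d` have rank at most `d` -/

section Binary

theorem dirDeriv_eq (w : Fin 2 → ℂ) (p : MvPolynomial (Fin 2) ℂ) :
    dirDeriv w p = C (w 0) * pderiv 0 p + C (w 1) * pderiv 1 p := by
  have h : dirDeriv w = (C (w 0) : MvPolynomial (Fin 2) ℂ) • pderiv 0 +
      (C (w 1) : MvPolynomial (Fin 2) ℂ) • pderiv 1 := by
    refine derivation_ext fun i => ?_
    fin_cases i <;> simp [dirDeriv, mkDerivation_X, pderiv_X]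
  rw [h]
  simp

/-- The binary linear form vanishing at `w`. -/
def vanishingForm (w : Fin 2 → ℂ) : LinForm (Fin 2) := w 1 • varForm 0 - w 0 • varForm 1

theorem coe_vanishingForm (w : Fin 2 → ℂ) :
    (vanishingForm w : MvPolynomial (Fin 2) ℂ) = C (w 1) * X 0 - C (w 0) * X 1 := by
  simp [vanishingForm, smul_eq_C_mul]

/-- Euler's identity and `dirDeriv w e = 0` show that, up to a nonzero constant, `e` is the
vanishing form times `pderiv 0 e`, which is again killed by `dirDeriv w`. -/
theorem eq_C_mul_pow_of_dirDeriv_eq_zero {w : Fin 2 → ℂ} (hw : w 1 ≠ 0) (d : ℕ)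
    (e : MvPolynomial (Fin 2) ℂ) (he : e.IsHomogeneous d) (h : dirDeriv w e = 0) :
    ∃ c : ℂ, e = C c * (vanishingForm w : MvPolynomial (Fin 2) ℂ) ^ d := by
  induction d generalizing e with
  | zero =>
    rw [← totalDegree_zero_iff_isHomogeneous, totalDegree_eq_zero_iff_eq_C] at he
    exact ⟨_, by simpa using he⟩
  | succ d ih =>
    have hcomm : dirDeriv w (pderiv 0 e) = pderiv 0 (dirDeriv w e) := by
      have h1 : ⁅dirDeriv w, (pderiv 0 : Derivation ℂ (MvPolynomial (Fin 2) ℂ) _)⁆ = 0 := by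
        refine derivation_ext fun i => ?_
        fin_cases i <;> simp [Derivation.commutator_apply, dirDeriv, mkDerivation_X, pderiv_X]
      have h2 := congrArg (fun D => D e) h1
      simpa [Derivation.commutator_apply, sub_eq_zero] using h2
    obtain ⟨c, hc⟩ := ih (pderiv 0 e) he.pderiv (by rw [hcomm, h, map_zero])
    have euler := he.sum_X_mul_pderiv
    rw [Fin.sum_univ_two, nsmul_eq_mul] at euler
    rw [dirDeriv_eq] at h
    have h3 : C (w 1 * (d + 1)) * e = C c * (vanishingForm w : MvPolynomial (Fin 2) ℂ) ^ (d + 1) := by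
      have : C (w 1 * (d + 1)) * e =
          (vanishingForm w : MvPolynomial (Fin 2) ℂ) * pderiv 0 e := by
        rw [coe_vanishingForm]
        push_cast at euler
        simp only [map_mul, map_add, map_natCast, map_one]
        linear_combination (-C (w 1)) * euler + X 1 * h
      rw [this, hc]
      ring
    have hne : w 1 * (d + 1) ≠ 0 := mul_ne_zero hw (Nat.cast_add_one_ne_zero d)
    refine ⟨(w 1 * (d + 1))⁻¹ * c, ?_⟩
    rw [C_mul, mul_assoc, ← h3, ← mul_assoc, ← C_mul, inv_mul_cancel₀ hne, C_1, one_mul]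

/-- Each condition on `w` is the nonvanishing of a nonzero polynomial, so all hold at a point where
the product `P` does not vanish. Euler's identity at `v` makes the derivative factors nonzero; the
others are nonzero because `h` vanishes at the origin, so `v ≠ 0`. -/
theorem exists_generic_direction {d : ℕ} {h : MvPolynomial (Fin 2) ℂ}
    (hh : h.IsHomogeneous (d + 1)) (h0 : h ≠ 0) (F : Finset (Fin 2 → ℂ))
    (hF : ∀ v ∈ F, eval v h ≠ 0) :
    ∃ w : Fin 2 → ℂ, eval w h ≠ 0 ∧ w 1 ≠ 0 ∧
      ∀ v ∈ F, eval v (dirDeriv w h) ≠ 0 ∧ evalForm v (vanishingForm w) ≠ 0 := by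
  let P : MvPolynomial (Fin 2) ℂ := h * X 1 * ∏ v ∈ F,
    ((X 0 * C (eval v (pderiv 0 h)) + X 1 * C (eval v (pderiv 1 h))) *
      (X 1 * C (v 0) - X 0 * C (v 1)))
  have hP : P ≠ 0 := by
    refine mul_ne_zero (mul_ne_zero h0 (X_ne_zero _)) (Finset.prod_ne_zero_iff.2 fun v hv => ?_)
    have hv0 := hF v hv
    refine mul_ne_zero (fun hz => hv0 ?_) (fun hz => hv0 ?_)
    · have e1 := congrArg (eval v) hz
      have e2 := congrArg (eval v) hh.sum_X_mul_pderiv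
      simp only [Fin.sum_univ_two, map_add, map_mul, eval_X, eval_C, map_zero, nsmul_eq_mul,
        map_natCast] at e1 e2
      rw [e1] at e2
      exact (mul_eq_zero.1 e2.symm).resolve_left (Nat.cast_ne_zero.2 (Nat.succ_ne_zero d))
    · have e1 := congrArg (eval ![0, 1]) hz
      have e2 := congrArg (eval ![1, 0]) hz
      simp at e1 e2
      have hv' : v = 0 := by
        ext i; fin_cases i <;> simp [e1, e2]
      rw [hv']
      have := hh.coeff_eq_zero (d := 0) (by simp)
      rw [← constantCoeff_eq] at this
      simpa using this
  obtain ⟨w, hw⟩ : ∃ w, eval w P ≠ 0 := by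
    by_contra! hcon
    exact hP (MvPolynomial.funext fun w => by simp [hcon w])
  simp only [P, map_mul, eval_X, map_prod, map_add, map_sub, eval_C] at hw
  rw [mul_ne_zero_iff, mul_ne_zero_iff, Finset.prod_ne_zero_iff] at hw
  refine ⟨w, hw.1.1, hw.1.2, fun v hv => ?_⟩
  have h1 := mul_ne_zero_iff.1 (hw.2 v hv)
  refine ⟨?_, ?_⟩
  · simpa [dirDeriv_eq] using h1.1
  · rw [evalForm_apply, coe_vanishingForm]
    intro hz
    apply h1.2
    simp only [map_sub, map_mul, eval_C, eval_X] at hz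
    linear_combination hz

/-- Decompose a derivative `dirDeriv w h` and integrate term by term; the error is killed by
`dirDeriv w`, so it costs one more power. Integration divides by `evalForm w ℓ`, and the avoidance
clause is what lets the induction keep this nonzero. -/
theorem exists_waringDecomposition_avoiding (d : ℕ) (h : MvPolynomial (Fin 2) ℂ)
    (hh : h.IsHomogeneous (d + 1)) (F : Finset (Fin 2 → ℂ)) (hF : ∀ v ∈ F, eval v h ≠ 0) :
    ∃ L : Multiset (LinForm (Fin 2)), IsWaringDecomposition (d + 1) h L ∧
      Multiset.card L ≤ d + 1 ∧ ∀ ℓ ∈ L, ∀ v ∈ F, evalForm v ℓ ≠ 0 := by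
  classical
  induction d generalizing h F with
  | zero =>
    refine ⟨{⟨h, hh⟩}, by simp [isWaringDecomposition_iff], by simp, ?_⟩
    intro ℓ hℓ v hv
    rw [Multiset.mem_singleton.1 hℓ, evalForm_apply]
    exact hF v hv
  | succ d ih =>
    by_cases h0 : h = 0
    · exact ⟨0, by simp [isWaringDecomposition_iff, h0], by simp, by simp⟩
    obtain ⟨w, hw0, hw1, hw⟩ := exists_generic_direction hh h0 F hF
    have hDh : (dirDeriv w h).IsHomogeneous (d + 1) := by
      rw [dirDeriv_eq]
      exact (hh.pderiv.C_mul _).add (hh.pderiv.C_mul _)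
    -- The point `w` may be added to `F`: by Euler, the derivative at `w` is a nonzero multiple of
    -- `eval w h`.
    obtain ⟨L, hL, hcard, hav⟩ := ih (dirDeriv w h) hDh (insert w F) (by
      intro v hv
      rcases Finset.mem_insert.1 hv with rfl | hv
      · have e2 := congrArg (eval v) hh.sum_X_mul_pderiv
        rw [dirDeriv_eq]
        simp only [Fin.sum_univ_two, map_add, map_mul, eval_X, eval_C, nsmul_eq_mul,
          map_natCast] at e2 ⊢
        rw [e2]
        exact mul_ne_zero (Nat.cast_ne_zero.2 (by omega)) hw0
      · exact (hw v hv).1)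
    choose ρ hρ using fun z : ℂ => IsAlgClosed.exists_pow_nat_eq z (Nat.succ_pos (d + 1))
    have hρ0 : ∀ z, z ≠ 0 → ρ z ≠ 0 := fun z hz hz' => hz (by rw [← hρ z, hz']; simp)
    have hLw : ∀ ℓ ∈ L, evalForm w ℓ ≠ 0 := fun ℓ hℓ => hav ℓ hℓ w (Finset.mem_insert_self _ _)
    let r : LinForm (Fin 2) → ℂ := fun ℓ => (((d + 1 : ℕ) + 1 : ℂ) * evalForm w ℓ)⁻¹
    have hd2 : (((d + 1 : ℕ) + 1 : ℂ)) ≠ 0 := Nat.cast_add_one_ne_zero _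
    have hr : ∀ ℓ ∈ L, r ℓ ≠ 0 := fun ℓ hℓ => inv_ne_zero (mul_ne_zero hd2 (hLw ℓ hℓ))
    let L' := L.map fun ℓ => ρ (r ℓ) • ℓ
    have hsum : dirDeriv w (powSum (d + 1 + 1) L') =
        dirDeriv w h := by
      rw [isWaringDecomposition_iff.1 hL, powSum, powSum, map_multiset_sum, Multiset.map_map,
        Multiset.map_map]
      refine congrArg _ (Multiset.map_congr rfl fun ℓ hℓ => ?_)
      simp only [Function.comp_apply, Submodule.coe_smul, smul_pow]
      rw [hρ, Derivation.map_smul, dirDeriv_pow, smul_eq_C_mul, ← mul_assoc, ← C_mul,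
        inv_mul_cancel₀ (mul_ne_zero hd2 (hLw ℓ hℓ)), C_1, one_mul]
    obtain ⟨c, hc⟩ := eq_C_mul_pow_of_dirDeriv_eq_zero hw1 (d + 1 + 1)
      (h - powSum (d + 1 + 1) L')
      (hh.sub (isHomogeneous_powSum _ _)) (by rw [map_sub, hsum, sub_self])
    have hav' : ∀ ℓ ∈ L', ∀ v ∈ F, evalForm v ℓ ≠ 0 := by
      intro ℓ hℓ v hv
      obtain ⟨m, hm, rfl⟩ := Multiset.mem_map.1 hℓ
      rw [map_smul, smul_eq_mul]
      exact mul_ne_zero (hρ0 _ (hr m hm)) (hav m hm v (Finset.mem_insert_of_mem hv))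
    have hcard' : Multiset.card L' ≤ d + 1 := by simpa [L'] using hcard
    by_cases hc0 : c = 0
    · refine ⟨L', ?_, by omega, hav'⟩
      rw [hc0, C_0, zero_mul, sub_eq_zero] at hc
      exact isWaringDecomposition_iff.2 hc
    · refine ⟨(ρ c • vanishingForm w) ::ₘ L', ?_, by simpa using hcard', ?_⟩
      · rw [isWaringDecomposition_iff, powSum_cons, Submodule.coe_smul, smul_pow, hρ, smul_eq_C_mul, ← hc]
        ring
      · intro ℓ hℓ v hv
        rcases Multiset.mem_cons.1 hℓ with rfl | hℓ
        · rw [map_smul, smul_eq_mul]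
          exact mul_ne_zero (hρ0 _ hc0) (hw v hv).2
        · exact hav' ℓ hℓ v hv

theorem waringRank_le_card {σ : Type*} {d : ℕ} {f : MvPolynomial σ ℂ} {L : Multiset (LinForm σ)}
    (h : IsWaringDecomposition d f L) : waringRank d f ≤ Multiset.card L :=
  Nat.sInf_le ⟨L, h, rfl⟩

theorem IsWaringDecomposition.exists_minimal {σ : Type*} {d : ℕ} {f : MvPolynomial σ ℂ}
    {L : Multiset (LinForm σ)} (h : IsWaringDecomposition d f L) :
    ∃ M, IsMinimalWaringDecomposition d f M :=
  Nat.sInf_mem (s := {s : ℕ | ∃ L : Multiset (LinForm σ),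
    IsWaringDecomposition d f L ∧ Multiset.card L = s}) ⟨_, L, h, rfl⟩

theorem exists_minimal_binary {d : ℕ} (hd : 0 < d) {h : MvPolynomial (Fin 2) ℂ}
    (hh : h.IsHomogeneous d) :
    ∃ M, IsMinimalWaringDecomposition d h M ∧ Multiset.card M ≤ d := by
  obtain ⟨d, rfl⟩ := Nat.exists_eq_succ_of_ne_zero hd.ne'
  obtain ⟨L, hL, hcard, -⟩ := exists_waringDecomposition_avoiding d h hh ∅ (by simp)
  obtain ⟨M, hM⟩ := hL.exists_minimal
  exact ⟨M, hM, hM.2 ▸ (waringRank_le_card hL).trans hcard⟩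

end Binary

end

/-! ### Separating a point from a finite set by hyperplanes -/

section Separation

variable {K V : Type*} [Field K] [AddCommGroup V] [Module K V]

/-- Some product of `k` linear functionals vanishes on `T` but not at `p`. -/
def IsSeparatedBy (K : Type*) {V : Type*} [Field K] [AddCommGroup V] [Module K V]
    (k : ℕ) (p : V) (T : Set V) : Prop :=
  ∃ Φ : List (Module.Dual K V), Φ.length = k ∧ (Φ.map fun φ => φ p).prod ≠ 0 ∧
    ∀ q ∈ T, (Φ.map fun φ => φ q).prod = 0

theorem IsSeparatedBy.mono {k : ℕ} {p : V} {T U : Set V} (h : IsSeparatedBy K k p U)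
    (hTU : T ⊆ U) : IsSeparatedBy K k p T := by
  obtain ⟨Φ, h1, h2, h3⟩ := h
  exact ⟨Φ, h1, h2, fun q hq => h3 q (hTU hq)⟩

theorem IsSeparatedBy.union_submodule {k : ℕ} {p : V} {T : Set V} (h : IsSeparatedBy K k p T)
    {W : Submodule K V} (hp : p ∉ W) : IsSeparatedBy K (k + 1) p (T ∪ W) := by
  obtain ⟨Φ, h1, h2, h3⟩ := h
  obtain ⟨φ, hφ, hW⟩ := Submodule.exists_le_ker_of_notMem hp
  refine ⟨φ :: Φ, by simp [h1], by simp [hφ, h2], ?_⟩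
  rintro q (hq | hq)
  · simp [h3 q hq]
  · have : φ q = 0 := hW hq
    simp [this]

theorem IsSeparatedBy.of_card_le {k : ℕ} {p : V} {T : Finset V} (hp : p ≠ 0)
    (hT : ∀ q ∈ T, p ∉ Submodule.span K {q}) (hk : T.card ≤ k) : IsSeparatedBy K k p (T : Set V) := by
  classical
  induction k generalizing T with
  | zero =>
    rw [Nat.le_zero, Finset.card_eq_zero] at hk
    exact ⟨[], by simp, by simp, by simp [hk]⟩
  | succ k ih =>
    rcases T.eq_empty_or_nonempty with rfl | ⟨q, hq⟩
    -- Exactly `k + 1` functionals are required, so spare ones are filled by functionals nonzero at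
    -- `p`.
    · exact ((ih (T := ∅) (by simp) (by simp)).union_submodule (W := ⊥) (by simpa using hp)).mono
        (by simp)
    · have h1 := ih (T := T.erase q) (fun r hr => hT r (Finset.mem_of_mem_erase hr))
        (by rw [Finset.card_erase_of_mem hq]; omega)
      refine (h1.union_submodule (hT q hq)).mono fun r hr => ?_
      by_cases hrq : r = q
      · exact Or.inr (hrq ▸ Submodule.mem_span_singleton_self _)
      · exact Or.inl (by simpa [hrq] using hr)

/-- One functional per point handles `k + 1` points. Beyond that, a functional must kill several
points at once: a whole line with at least three points, or else one or two pairs, whose lines miss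
`p` when no three points are collinear. -/
theorem exists_isSeparatedBy_or_collinear {S : Finset V} (hS : S.Nonempty)
    (hS0 : ∀ p ∈ S, p ≠ 0) (hind : ∀ p ∈ S, ∀ q ∈ S, p ≠ q → p ∉ Submodule.span K {q})
    {k : ℕ} (hk : 2 ≤ k) (hcard : S.card ≤ k + 3) :
    (∃ p ∈ S, IsSeparatedBy K k p {q | q ∈ S ∧ q ≠ p}) ∨
      k + 2 ≤ S.card ∧ ∃ p ∈ S, ∃ q ∈ S, ∀ r ∈ S, r ∈ Submodule.span K {p, q} := by
  classical
  have sep : ∀ p ∈ S, ∀ (T : Finset V) (j : ℕ), T ⊆ S → p ∉ T → T.card ≤ j →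
      IsSeparatedBy K j p (T : Set V) := fun p hp T j hT hpT hj =>
    .of_card_le (hS0 p hp) (fun q hq => hind p hp q (hT hq) fun h => hpT (h ▸ hq)) hj
  by_cases hsmall : S.card ≤ k + 1
  · obtain ⟨p, hp⟩ := hS
    refine Or.inl ⟨p, hp, (sep p hp (S.erase p) k (Finset.erase_subset _ _) (by simp)
      (by rw [Finset.card_erase_of_mem hp]; omega)).mono fun q hq => by simpa [and_comm] using hq⟩
  by_cases hcol : ∃ p ∈ S, ∃ q ∈ S, ∀ r ∈ S, r ∈ Submodule.span K {p, q}
  · exact Or.inr ⟨by omega, hcol⟩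
  push Not at hcol
  left
  by_cases htri : ∃ p ∈ S, ∃ q ∈ S, ∃ r ∈ S, p ≠ q ∧ r ≠ p ∧ r ≠ q ∧ r ∈ Submodule.span K {p, q}
  · obtain ⟨p, hp, q, hq, r, hr, hpq, hrp, hrq, hrm⟩ := htri
    obtain ⟨s, hs, hsm⟩ := hcol p hp q hq
    have hps : p ∈ Submodule.span K {p, q} := Submodule.subset_span (by simp)
    have hqs : q ∈ Submodule.span K {p, q} := Submodule.subset_span (by simp)
    have hsp : s ≠ p := fun h => hsm (h ▸ hps)
    have hsq : s ≠ q := fun h => hsm (h ▸ hqs)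
    have hsr : s ≠ r := fun h => hsm (h ▸ hrm)
    -- One functional is reserved for the line through `p`, `q`, `r`; at most `k - 1` points besides
    -- these and `s` remain.
    obtain ⟨k, rfl⟩ : ∃ j, k = j + 1 := ⟨k - 1, by omega⟩
    have h1 := sep s hs ((((S.erase s).erase p).erase q).erase r) k
      (fun x hx => by simp at hx; tauto) (by simp)
      (by
        rw [Finset.card_erase_of_mem, Finset.card_erase_of_mem, Finset.card_erase_of_mem,
          Finset.card_erase_of_mem] <;> simp_all [eq_comm])
    refine ⟨s, hs, (h1.union_submodule hsm).mono fun t ht => ?_⟩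
    by_cases ht' : t ∈ Submodule.span K {p, q}
    · exact Or.inr ht'
    · refine Or.inl ?_
      simp only [Finset.mem_coe, Finset.mem_erase]
      exact ⟨fun h => ht' (h ▸ hrm), fun h => ht' (h ▸ hqs), fun h => ht' (h ▸ hps), ht.2, ht.1⟩
  · push Not at htri
    obtain ⟨p, hp⟩ := hS
    have c1 : (S.erase p).card = S.card - 1 := Finset.card_erase_of_mem hp
    obtain ⟨q, hq, r, hr, hqr⟩ := Finset.one_lt_card.1 (show 1 < (S.erase p).card by omega)
    have c2 : (((S.erase p).erase q).erase r).card = S.card - 3 := by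
      rw [Finset.card_erase_of_mem (Finset.mem_erase.2 ⟨hqr.symm, hr⟩),
        Finset.card_erase_of_mem hq]
      omega
    have line : ∀ a ∈ S.erase p, ∀ b ∈ S.erase p, a ≠ b → p ∉ Submodule.span K {a, b} := by
      intro a ha b hb hab
      rw [Finset.mem_erase] at ha hb
      exact htri a ha.2 b hb.2 p hp hab ha.1.symm hb.1.symm
    have mem : ∀ a b : V, a ∈ Submodule.span K {a, b} ∧ b ∈ Submodule.span K {a, b} :=
      fun a b => ⟨Submodule.subset_span (by simp), Submodule.subset_span (by simp)⟩
    refine ⟨p, hp, ?_⟩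
    by_cases hc : S.card = k + 2
    · obtain ⟨k, rfl⟩ : ∃ j, k = j + 1 := ⟨k - 1, by omega⟩
      have h1 := sep p hp (((S.erase p).erase q).erase r) k
        (fun x hx => by simp at hx; tauto) (by simp) (by omega)
      refine (h1.union_submodule (line q hq r hr hqr)).mono fun t ht => ?_
      by_cases htq : t = q
      · exact Or.inr (htq ▸ (mem q r).1)
      by_cases htr : t = r
      · exact Or.inr (htr ▸ (mem q r).2)
      exact Or.inl (by simp [htq, htr, ht.1, ht.2])
    -- With `k + 3` points two functionals each absorb a pair, leaving `k - 2` points; this is where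
    -- `2 ≤ k` is needed.
    · obtain ⟨k, rfl⟩ : ∃ j, k = j + 1 + 1 := ⟨k - 2, by omega⟩
      obtain ⟨u, hu, v, hv, huv⟩ := Finset.one_lt_card.1
        (show 1 < (((S.erase p).erase q).erase r).card by omega)
      have hu' := Finset.mem_of_mem_erase (Finset.mem_of_mem_erase hu)
      have hv' := Finset.mem_of_mem_erase (Finset.mem_of_mem_erase hv)
      have h1 := sep p hp (((((S.erase p).erase q).erase r).erase u).erase v) k
        (fun x hx => by simp at hx; tauto) (by simp) (by
          rw [Finset.card_erase_of_mem (Finset.mem_erase.2 ⟨huv.symm, hv⟩),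
            Finset.card_erase_of_mem hu]
          omega)
      refine ((h1.union_submodule (line q hq r hr hqr)).union_submodule
        (line u hu' v hv' huv)).mono fun t ht => ?_
      by_cases htq : t = q
      · exact Or.inl (Or.inr (htq ▸ (mem q r).1))
      by_cases htr : t = r
      · exact Or.inl (Or.inr (htr ▸ (mem q r).2))
      by_cases htu : t = u
      · exact Or.inr (htu ▸ (mem u v).1)
      by_cases htv : t = v
      · exact Or.inr (htv ▸ (mem u v).2)
      exact Or.inl (Or.inl (by simp [htq, htr, htu, htv, ht.1, ht.2]))

end Separation

noncomputable section

open MvPolynomial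

/-! ### Ternary forms involving `x_0` whose power sum is free of `x_0` -/

section Ternary

/-- The coefficient of `x_0` in a ternary linear form. -/
def leadCoeff : LinForm (Fin 3) →ₗ[ℂ] ℂ := evalForm (Pi.single 0 1)

@[simp] theorem leadCoeff_varForm_zero : leadCoeff (varForm 0) = 1 := by simp [leadCoeff]

@[simp] theorem coe_binaryIncl (m : LinForm (Fin 2)) :
    (binaryIncl m : MvPolynomial (Fin 3) ℂ) = rename Fin.succ (m : MvPolynomial (Fin 2) ℂ) := rfl

theorem binaryIncl_varForm (i : Fin 2) : binaryIncl (varForm i) = varForm i.succ :=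
  Subtype.ext (by simp)

@[simp] theorem leadCoeff_binaryIncl (m : LinForm (Fin 2)) : leadCoeff (binaryIncl m) = 0 := by
  induction m using linForm_induction with
  | var i => simp [binaryIncl_varForm, leadCoeff]
  | zero => simp
  | add ℓ m h1 h2 => simp [h1, h2]
  | smul c ℓ h => simp [h]

theorem exists_eq_smul_varForm_add (ℓ : LinForm (Fin 3)) :
    ∃ m, ℓ = leadCoeff ℓ • varForm 0 + binaryIncl m := by
  induction ℓ using linForm_induction with
  | var i =>
    refine Fin.cases ⟨0, by simp⟩ (fun i => ⟨varForm i, ?_⟩) i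
    simp [← binaryIncl_varForm]
  | zero => exact ⟨0, by simp⟩
  | add ℓ m h1 h2 =>
    obtain ⟨a, ha⟩ := h1
    obtain ⟨b, hb⟩ := h2
    refine ⟨a + b, ?_⟩
    nth_rewrite 1 [ha, hb]
    rw [map_add, map_add, add_smul]
    abel
  | smul c ℓ h =>
    obtain ⟨a, ha⟩ := h
    refine ⟨c • a, ?_⟩
    nth_rewrite 1 [ha]
    rw [map_smul, map_smul, smul_add, smul_smul, smul_eq_mul]

theorem exists_eq_binaryIncl {ℓ : LinForm (Fin 3)} (h : leadCoeff ℓ = 0) :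
    ∃ m, ℓ = binaryIncl m := by
  obtain ⟨m, hm⟩ := exists_eq_smul_varForm_add ℓ
  exact ⟨m, by rw [hm, h]; simp⟩

theorem dirDeriv_single_rename (p : MvPolynomial (Fin 2) ℂ) :
    dirDeriv (Pi.single 0 1 : Fin 3 → ℂ) (rename Fin.succ p) = 0 := by
  induction p using MvPolynomial.induction_on with
  | C a => simp [dirDeriv]
  | add p q hp hq => simp [hp, hq]
  | mul_X p i hp =>
    have hX : dirDeriv (Pi.single 0 1 : Fin 3 → ℂ) (X i.succ) = 0 := by
      simp [dirDeriv, mkDerivation_X]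
    rw [map_mul, rename_X, Derivation.leibniz, hp, hX, smul_zero, smul_zero, add_zero]

theorem rename_powSum (d : ℕ) (M : Multiset (LinForm (Fin 2))) :
    rename Fin.succ (powSum d M) = powSum d (M.map binaryIncl) := by
  induction M using Multiset.induction_on with
  | empty => simp
  | cons ℓ M ih => simp [ih]

theorem exists_root_function {d : ℕ} (hd : 0 < d) : ∃ ρ : ℂ → ℂ, ∀ z, ρ z ^ d = z := by
  choose ρ hρ using fun z : ℂ => IsAlgClosed.exists_pow_nat_eq z hd
  exact ⟨ρ, hρ⟩

/-- Solve `p = 0` for `x_0` and substitute: this is the projection from `p` onto the binary forms.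
-/
theorem exists_map_eq_zero {p : LinForm (Fin 3)} (hp : leadCoeff p ≠ 0) :
    ∃ ψ : MvPolynomial (Fin 3) ℂ →ₐ[ℂ] MvPolynomial (Fin 2) ℂ,
      ψ (p : MvPolynomial (Fin 3) ℂ) = 0 ∧ ∀ h, ψ (rename Fin.succ h) = h := by
  obtain ⟨m, hm⟩ := exists_eq_smul_varForm_add p
  refine ⟨aeval (Fin.cons (-(C (leadCoeff p)⁻¹ * (m : MvPolynomial (Fin 2) ℂ))) X), ?_, ?_⟩
  · rw [hm]
    simp only [map_add, map_smul, leadCoeff_binaryIncl, leadCoeff_varForm_zero, smul_eq_mul,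
      mul_one, add_zero, Submodule.coe_add, Submodule.coe_smul, coe_varForm, coe_binaryIncl,
      aeval_X, aeval_rename, Fin.cons_zero]
    rw [show (Fin.cons (-(C (leadCoeff p)⁻¹ * (m : MvPolynomial (Fin 2) ℂ))) X :
      Fin 3 → MvPolynomial (Fin 2) ℂ) ∘ Fin.succ = X by ext1 i; simp, aeval_X_left_apply,
      smul_eq_C_mul, mul_neg, ← mul_assoc, ← C_mul, mul_inv_cancel₀ hp, C_1, one_mul,
      neg_add_cancel]
  · intro h
    rw [aeval_rename, show (Fin.cons (-(C (leadCoeff p)⁻¹ * (m : MvPolynomial (Fin 2) ℂ))) X :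
      Fin 3 → MvPolynomial (Fin 2) ℂ) ∘ Fin.succ = X by ext1 i; simp, aeval_X_left_apply]

/-- Projection from `p` fixes `h` and sends every form on the line to a multiple of the image `m` of
`q`, so `h` is a multiple of `m ^ d`. -/
theorem waringRank_le_one_of_collinear {d : ℕ} (hd : 0 < d) {h : MvPolynomial (Fin 2) ℂ}
    {N : Multiset (LinForm (Fin 3))} (hN : rename Fin.succ h = powSum d N)
    {p q : LinForm (Fin 3)} (hp : leadCoeff p ≠ 0)
    (hcol : ∀ ℓ ∈ N, ℓ ∈ Submodule.span ℂ {p, q}) : waringRank d h ≤ 1 := by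
  obtain ⟨ρ, hρ⟩ := exists_root_function hd
  obtain ⟨ψ, hψp, hψ⟩ := exists_map_eq_zero hp
  obtain ⟨m, hm⟩ : ∃ m, q - (leadCoeff q / leadCoeff p) • p = binaryIncl m :=
    exists_eq_binaryIncl (by simp [hp])
  have hψq : ψ (q : MvPolynomial (Fin 3) ℂ) = (m : MvPolynomial (Fin 2) ℂ) := by
    have h1 := congrArg (fun ℓ : LinForm (Fin 3) => ψ (ℓ : MvPolynomial (Fin 3) ℂ)) hm
    simpa [hψp, hψ] using h1
  have key : ∃ c : ℂ, ψ (powSum d N) = C c * (m : MvPolynomial (Fin 2) ℂ) ^ d := by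
    clear hN
    induction N using Multiset.induction_on with
    | empty => exact ⟨0, by simp⟩
    | cons ℓ N ih =>
      obtain ⟨c, hc⟩ := ih fun ℓ hℓ => hcol ℓ (Multiset.mem_cons_of_mem hℓ)
      obtain ⟨a, b, rfl⟩ := Submodule.mem_span_pair.1 (hcol ℓ (Multiset.mem_cons_self _ _))
      refine ⟨b ^ d + c, ?_⟩
      rw [powSum_cons, map_add, hc, map_pow, Submodule.coe_add, Submodule.coe_smul,
        Submodule.coe_smul, map_add, map_smul, map_smul, hψp, hψq, smul_zero, zero_add,
        smul_eq_C_mul, mul_pow, C_add, C_pow, add_mul]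
  obtain ⟨c, hc⟩ := key
  rw [← hN, hψ] at hc
  refine waringRank_le_card (L := {ρ c • m}) (isWaringDecomposition_iff.2 ?_)
  rw [hc, powSum_singleton, Submodule.coe_smul, smul_pow, hρ, smul_eq_C_mul]

/-- A sum of powers of ternary linear forms that all involve `x_0` can only be free of `x_0` if
there are many summands. -/
theorem waringRank_add_three_le {d : ℕ} (hd : 3 ≤ d) {h : MvPolynomial (Fin 2) ℂ}
    (hh : h.IsHomogeneous d) (h0 : h ≠ 0) (n : ℕ) (N : Multiset (LinForm (Fin 3)))
    (hn : Multiset.card N = n) (hN0 : ∀ ℓ ∈ N, leadCoeff ℓ ≠ 0)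
    (hN : rename Fin.succ h = powSum d N) : waringRank d h + 3 ≤ n := by
  classical
  induction n using Nat.strong_induction_on generalizing N with
  | _ n ih =>
  obtain ⟨ρ, hρ⟩ := exists_root_function (show 0 < d by omega)
  -- Two proportional members merge into one power, or cancel when `c ^ d = -1`; either way `n`
  -- drops. Otherwise the members are pairwise independent, the case `c = 1` excluding repetitions.
  by_cases hred : ∃ (p : LinForm (Fin 3)) (c : ℂ) (M : Multiset (LinForm (Fin 3))),
      N = (c • p) ::ₘ p ::ₘ M
  · obtain ⟨p, c, M, rfl⟩ := hred
    rw [Multiset.card_cons, Multiset.card_cons] at hn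
    have hp : leadCoeff p ≠ 0 := hN0 p (by simp)
    have hM : ∀ ℓ ∈ M, leadCoeff ℓ ≠ 0 := fun ℓ hℓ => hN0 ℓ (by simp [hℓ])
    have hsum : rename Fin.succ h =
        (c ^ d + 1) • (p : MvPolynomial (Fin 3) ℂ) ^ d + powSum d M := by
      rw [hN, powSum_cons, powSum_cons, Submodule.coe_smul, smul_pow, add_smul, one_smul, add_assoc]
    by_cases hz : c ^ d + 1 = 0
    · have := ih (n - 2) (by omega) M (by omega) hM (by rw [hsum, hz]; simp)
      omega
    · have hρ0 : ρ (c ^ d + 1) ≠ 0 := fun h' => hz (by rw [← hρ (c ^ d + 1), h', zero_pow (by omega)])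
      have := ih (n - 1) (by omega) ((ρ (c ^ d + 1) • p) ::ₘ M) (by simp; omega)
        (by
          intro ℓ hℓ
          rcases Multiset.mem_cons.1 hℓ with rfl | hℓ
          · simp [hp, hρ0]
          · exact hM ℓ hℓ)
        (by rw [hsum, powSum_cons, Submodule.coe_smul, smul_pow, hρ])
      omega
  have hnd : N.Nodup := by
    rw [Multiset.nodup_iff_ne_cons_cons]
    intro p M hM
    exact hred ⟨p, 1, M, by simpa using hM⟩
  have hind : ∀ p ∈ N.toFinset, ∀ q ∈ N.toFinset, p ≠ q → p ∉ Submodule.span ℂ {q} := by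
    intro p hp q hq hpq hmem
    rw [Multiset.mem_toFinset] at hp hq
    obtain ⟨c, rfl⟩ := Submodule.mem_span_singleton.1 hmem
    obtain ⟨M, rfl⟩ := Multiset.exists_cons_of_mem hp
    obtain ⟨M', rfl⟩ := Multiset.exists_cons_of_mem ((Multiset.mem_cons.1 hq).resolve_left hpq.symm)
    exact hred ⟨q, c, M', rfl⟩
  have hcard : N.toFinset.card = n := by rw [← hn, Multiset.toFinset_card_of_nodup hnd]
  have hne : N.toFinset.Nonempty := by
    rw [Multiset.toFinset_nonempty]
    rintro rfl
    rw [powSum_zero] at hN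
    exact h0 (rename_injective _ (Fin.succ_injective 2) (by simpa using hN))
  obtain ⟨M, hM, hMd⟩ := exists_minimal_binary (show 0 < d by omega) hh
  have hrk : waringRank d h ≤ d := hM.2 ▸ hMd
  by_cases hbig : d + 3 ≤ n
  · omega
  obtain ⟨k, rfl⟩ : ∃ k, d = k + 1 := ⟨d - 1, by omega⟩
  rcases exists_isSeparatedBy_or_collinear (K := ℂ) hne
    (fun p hp h' => hN0 p (Multiset.mem_toFinset.1 hp) (by simp [h'])) hind
    (show 2 ≤ k by omega) (by omega) with ⟨p, hp, Φ, hΦ, hΦp, hΦq⟩ | ⟨hk, p, hp, q, hq, hcol⟩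
  · exfalso
    -- The derivative of the power sum along `x_0`, zero since `h` is free of `x_0`. Evaluating on a
    -- separating product leaves only the nonzero term at `p`.
    have hrel : ∑ ℓ ∈ N.toFinset, C ((k + 1) * leadCoeff ℓ) *
        (ℓ : MvPolynomial (Fin 3) ℂ) ^ Φ.length = 0 := by
      have hpow : powSum (k + 1) N = ∑ ℓ ∈ N.toFinset, (ℓ : MvPolynomial (Fin 3) ℂ) ^ (k + 1) := by
        rw [Finset.sum, Multiset.toFinset_val, hnd.dedup]
        rfl
      rw [← dirDeriv_single_rename h, hN, hpow, map_sum, hΦ]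
      exact Finset.sum_congr rfl fun ℓ _ => (dirDeriv_pow _ ℓ k).symm
    have h1 := sum_mul_prod_eq_zero _ _ _ hrel
    rw [Finset.sum_eq_single_of_mem p hp (fun q hq hqp => by rw [hΦq q ⟨hq, hqp⟩, mul_zero])] at h1
    exact mul_ne_zero (mul_ne_zero (Nat.cast_add_one_ne_zero k)
      (hN0 p (Multiset.mem_toFinset.1 hp))) hΦp h1
  -- Here `n ≥ k + 2 ≥ 4`, which suffices once the rank is at most 1.
  · have := waringRank_le_one_of_collinear (show 0 < k + 1 by omega) hN
      (hN0 p (Multiset.mem_toFinset.1 hp)) fun ℓ hℓ => hcol ℓ (Multiset.mem_toFinset.2 hℓ)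
    omega

end Ternary

end

noncomputable section

open MvPolynomial

/-! ### The Waring locus through minimal decompositions -/

section Locus

variable {σ : Type*}

/-- The Waring locus consists of the classes of the nonzero forms in minimal decompositions. -/
theorem mem_waringLocus_iff {d : ℕ} (hd : 0 < d) {f : MvPolynomial σ ℂ}
    {P : ℙ ℂ (LinForm σ)} :
    P ∈ waringLocus d f ↔ ∃ L, IsMinimalWaringDecomposition d f L ∧
      ∃ ℓ ∈ L, ∃ hℓ : ℓ ≠ 0, P = Projectivization.mk ℂ ℓ hℓ := by
  classical
  constructor
  · rintro ⟨ℓ, hℓ, rfl, M, hM, hf⟩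
    obtain ⟨ρ, hρ⟩ := exists_root_function hd
    have hset : {m | m ∈ ℓ ::ₘ M} = (((ℓ ::ₘ M).toFinset : Finset (LinForm σ)) : Set _) := by
      ext m; simp
    rw [hset] at hf
    obtain ⟨c, hc⟩ := (Submodule.mem_span_image_finset_iff_exists_fun' ℂ).1 hf
    let T := (ℓ ::ₘ M).toFinset
    have hℓT : ℓ ∈ T := by simp [T]
    have hT : T.card ≤ waringRank d f := by
      rw [← hM, ← Multiset.card_cons ℓ M]
      exact Multiset.toFinset_card_le _
    -- Roots of the coefficients turn a linear combination into a sum of powers. By minimality `T`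
    -- has exactly `rk(f)` elements, and `c ℓ = 0` would allow `ℓ` to be dropped.
    have dec : ∀ U ⊆ T, (∀ m ∈ T, m ∉ U → c m = 0) →
        IsWaringDecomposition d f (U.val.map fun m => ρ (c m) • m) := by
      intro U hU hcU
      rw [isWaringDecomposition_iff, ← hc, powSum, Multiset.map_map]
      refine (Finset.sum_subset hU fun m hm hmU => by rw [hcU m hm hmU, zero_smul]).symm.trans ?_
      refine Finset.sum_congr rfl fun m _ => ?_
      rw [Function.comp_apply, Submodule.coe_smul, smul_pow, hρ]
    have hT' := waringRank_le_card (dec T subset_rfl fun m hm hm' => absurd hm hm')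
    rw [Multiset.card_map, Finset.card_val] at hT'
    have hcℓ : c ℓ ≠ 0 := by
      intro h0
      have h1 := waringRank_le_card (dec (T.erase ℓ) (Finset.erase_subset _ _) (by
        intro m hm hm'
        have : m = ℓ := by simpa [hm] using hm'
        rw [this, h0]))
      rw [Multiset.card_map, Finset.card_val, Finset.card_erase_of_mem hℓT] at h1
      have := Finset.card_pos.2 ⟨ℓ, hℓT⟩
      omega
    have hρℓ : ρ (c ℓ) ≠ 0 := fun h0 => hcℓ (by rw [← hρ (c ℓ), h0, zero_pow hd.ne'])
    refine ⟨_, ⟨dec T subset_rfl fun m hm hm' => absurd hm hm', ?_⟩, ρ (c ℓ) • ℓ,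
      Multiset.mem_map_of_mem _ hℓT, smul_ne_zero hρℓ hℓ, ?_⟩
    · rw [Multiset.card_map, Finset.card_val]
      omega
    · rw [Projectivization.mk_eq_mk_iff']
      exact ⟨(ρ (c ℓ))⁻¹, by rw [smul_smul, inv_mul_cancel₀ hρℓ, one_smul]⟩
  · rintro ⟨L, ⟨hL, hcard⟩, ℓ, hℓL, hℓ, rfl⟩
    obtain ⟨M, rfl⟩ := Multiset.exists_cons_of_mem hℓL
    refine ⟨ℓ, hℓ, rfl, M, by rw [← hcard, Multiset.card_cons], ?_⟩
    rw [isWaringDecomposition_iff.1 hL, powSum]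
    refine multiset_sum_mem _ fun p hp => ?_
    obtain ⟨m, hm, rfl⟩ := Multiset.mem_map.1 hp
    exact Submodule.subset_span ⟨m, hm, rfl⟩

end Locus

/-! ### Decompositions of `x_0 ^ d + g` -/

section Sum

variable {d : ℕ} {g : MvPolynomial (Fin 2) ℂ}

theorem isWaringDecomposition_cons_map {ζ : ℂ} (hζ : ζ ^ d = 1) {M : Multiset (LinForm (Fin 2))}
    (hM : IsWaringDecomposition d g M) :
    IsWaringDecomposition d (X 0 ^ d + rename Fin.succ g)
      ((ζ • varForm 0) ::ₘ M.map binaryIncl) := by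
  rw [isWaringDecomposition_iff] at hM ⊢
  rw [powSum_cons, ← rename_powSum, ← hM, Submodule.coe_smul, smul_pow, hζ, one_smul, coe_varForm]

theorem exists_eq_map_binaryIncl {B : Multiset (LinForm (Fin 3))}
    (hB : ∀ ℓ ∈ B, leadCoeff ℓ = 0) : ∃ B' : Multiset (LinForm (Fin 2)), B = B'.map binaryIncl := by
  induction B using Multiset.induction_on with
  | empty => exact ⟨0, rfl⟩
  | cons ℓ B ih =>
    obtain ⟨B', rfl⟩ := ih fun m hm => hB m (Multiset.mem_cons_of_mem hm)
    obtain ⟨m, rfl⟩ := exists_eq_binaryIncl (hB ℓ (Multiset.mem_cons_self _ _))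
    exact ⟨m ::ₘ B', by simp⟩

theorem eq_smul_varForm_of_pow_eq (hd : 0 < d) {ℓ : LinForm (Fin 3)}
    (h : (ℓ : MvPolynomial (Fin 3) ℂ) ^ d = X 0 ^ d) :
    ∃ ζ : ℂ, ζ ^ d = 1 ∧ ℓ = ζ • varForm 0 := by
  obtain ⟨m, hm⟩ := exists_eq_smul_varForm_add ℓ
  -- Setting `x_0 = 0` leaves `m ^ d = 0`, so `ℓ` has no binary part.
  obtain ⟨ψ, h0, hψ⟩ := exists_map_eq_zero (p := varForm 0) (by simp)
  rw [coe_varForm] at h0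
  have h1 := congrArg ψ h
  rw [map_pow, map_pow, h0, zero_pow hd.ne', hm, Submodule.coe_add, Submodule.coe_smul,
    coe_varForm, coe_binaryIncl, map_add, map_smul, h0, smul_zero, zero_add, hψ] at h1
  have hm0 : m = 0 := Subtype.ext (eq_zero_of_pow_eq_zero h1)
  rw [hm0, map_zero, add_zero] at hm
  refine ⟨leadCoeff ℓ, ?_, hm⟩
  rw [hm, Submodule.coe_smul, smul_pow, coe_varForm] at h
  have h2 : (leadCoeff ℓ ^ d - 1) • (X 0 : MvPolynomial (Fin 3) ℂ) ^ d = 0 := by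
    rw [sub_smul, h, one_smul, sub_self]
  exact sub_eq_zero.1 ((smul_eq_zero.1 h2).resolve_right (pow_ne_zero _ (X_ne_zero 0)))

theorem exists_eq_cons_map_of_card_le (hd : 3 ≤ d) (hg : g.IsHomogeneous d)
    {L : Multiset (LinForm (Fin 3))}
    (hL : IsWaringDecomposition d (X 0 ^ d + rename Fin.succ g) L)
    (hcard : Multiset.card L ≤ waringRank d g + 1) :
    ∃ (ζ : ℂ) (M : Multiset (LinForm (Fin 2))), ζ ^ d = 1 ∧
      IsMinimalWaringDecomposition d g M ∧ L = (ζ • varForm 0) ::ₘ M.map binaryIncl := by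
  classical
  have hd0 : 0 < d := by omega
  rw [isWaringDecomposition_iff] at hL
  obtain ⟨B', hB'⟩ : ∃ B' : Multiset (LinForm (Fin 2)),
      L.filter (fun ℓ => ¬ leadCoeff ℓ ≠ 0) = B'.map binaryIncl :=
    exists_eq_map_binaryIncl fun ℓ hℓ => not_not.1 (Multiset.mem_filter.1 hℓ).2
  obtain ⟨A, hA⟩ : ∃ A, A = L.filter fun ℓ => leadCoeff ℓ ≠ 0 := ⟨_, rfl⟩
  have hLAB : L = A + B'.map binaryIncl := by
    rw [hA, ← hB', Multiset.filter_add_not]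
  have hA0 : ∀ ℓ ∈ A, leadCoeff ℓ ≠ 0 := by
    intro ℓ hℓ
    rw [hA] at hℓ
    exact (Multiset.mem_filter.1 hℓ).2
  rw [hLAB, powSum_add, ← rename_powSum] at hL
  rw [hLAB, Multiset.card_add, Multiset.card_map] at hcard
  by_cases h0 : g - powSum d B' = 0
  · rw [sub_eq_zero] at h0
    rw [h0, add_left_inj] at hL
    have hrank := waringRank_le_card (isWaringDecomposition_iff.2 h0)
    have hA1 : Multiset.card A ≠ 0 := by
      intro h
      rw [Multiset.card_eq_zero.1 h, powSum_zero] at hL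
      exact pow_ne_zero _ (X_ne_zero 0) hL
    obtain ⟨ℓ, rfl⟩ := Multiset.card_eq_one.1 (show Multiset.card A = 1 by omega)
    rw [powSum_singleton] at hL
    obtain ⟨ζ, hζ, rfl⟩ := eq_smul_varForm_of_pow_eq hd0 hL.symm
    rw [Multiset.card_singleton] at hcard
    exact ⟨ζ, B', hζ, ⟨isWaringDecomposition_iff.2 h0, by omega⟩,
      by rw [hLAB, Multiset.singleton_add]⟩
  · exfalso
    have hh : (g - powSum d B').IsHomogeneous d := hg.sub (isHomogeneous_powSum d B')
    -- A `d`-th root of `-1` turns the term `- x_0 ^ d` into the power of a form involving `x_0`.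
    obtain ⟨ε, hε⟩ := IsAlgClosed.exists_pow_nat_eq (-1 : ℂ) hd0
    have hε0 : ε ≠ 0 := by
      rintro rfl
      rw [zero_pow hd0.ne'] at hε
      simp at hε
    have h1 := waringRank_add_three_le hd hh h0 _ ((ε • varForm 0) ::ₘ A) rfl
      (by
        intro ℓ hℓ
        rcases Multiset.mem_cons.1 hℓ with rfl | hℓ
        · simpa using hε0
        · exact hA0 ℓ hℓ)
      (by
        rw [powSum_cons, Submodule.coe_smul, smul_pow, hε, coe_varForm, map_sub, neg_one_smul]
        linear_combination hL)
    obtain ⟨M, ⟨hM, hMcard⟩, -⟩ := exists_minimal_binary hd0 hh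
    have h2 : IsWaringDecomposition d g (M + B') := by
      rw [isWaringDecomposition_iff] at hM ⊢
      rw [powSum_add, ← hM, sub_add_cancel]
    have h3 := waringRank_le_card h2
    rw [Multiset.card_add, hMcard] at h3
    rw [Multiset.card_cons] at h1
    omega

end Sum

end

theorem mainTheorem10 (d : ℕ) (hd : 0 < d) (g : MvPolynomial (Fin 2) ℂ)
    (hg : g.IsHomogeneous d) (f : MvPolynomial (Fin 3) ℂ)
    (hf : f = MvPolynomial.X 0 ^ d + MvPolynomial.rename Fin.succ g)
    (hrank : 4 ≤ waringRank d f) :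
    waringRank d f = waringRank d g + 1 ∧
    waringLocus d f =
      {Projectivization.mk ℂ (varForm 0) (varForm_ne_zero 0)} ∪
        Projectivization.map binaryIncl binaryIncl_injective '' waringLocus d g ∧
    ∀ L : Multiset (LinForm (Fin 3)), IsMinimalWaringDecomposition d f L ↔
      ∃ (ζ : ℂ) (M : Multiset (LinForm (Fin 2))), ζ ^ d = 1 ∧
        IsMinimalWaringDecomposition d g M ∧
        L = (ζ • varForm 0) ::ₘ M.map binaryIncl := by
  subst hf
  obtain ⟨M₀, hM₀, hM₀d⟩ := exists_minimal_binary hd hg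
  have hdec := isWaringDecomposition_cons_map (one_pow d) hM₀.1
  have hle := waringRank_le_card hdec
  rw [Multiset.card_cons, Multiset.card_map] at hle
  -- The rank hypothesis enters here: `4 ≤ rk(f) ≤ rk(g) + 1 ≤ d + 1`.
  have hd3 : 3 ≤ d := by omega
  rw [hM₀.2] at hle
  have hrk : waringRank d (MvPolynomial.X 0 ^ d + MvPolynomial.rename Fin.succ g) =
      waringRank d g + 1 := by
    obtain ⟨L, hL, hLcard⟩ := hdec.exists_minimal
    obtain ⟨ζ, M, -, hM, rfl⟩ := exists_eq_cons_map_of_card_le hd3 hg hL (hLcard.trans_le hle)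
    rw [← hLcard, Multiset.card_cons, Multiset.card_map, hM.2]
  have hmin : ∀ L : Multiset (LinForm (Fin 3)),
      IsMinimalWaringDecomposition d (MvPolynomial.X 0 ^ d + MvPolynomial.rename Fin.succ g) L ↔
      ∃ (ζ : ℂ) (M : Multiset (LinForm (Fin 2))), ζ ^ d = 1 ∧
        IsMinimalWaringDecomposition d g M ∧
        L = (ζ • varForm 0) ::ₘ M.map binaryIncl := by
    refine fun L => ⟨fun h => exists_eq_cons_map_of_card_le hd3 hg h.1 (h.2.trans_le hle), ?_⟩
    rintro ⟨ζ, M, hζ, hM, rfl⟩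
    exact ⟨isWaringDecomposition_cons_map hζ hM.1,
      by rw [Multiset.card_cons, Multiset.card_map, hM.2, hrk]⟩
  refine ⟨hrk, Set.ext fun P => ?_, hmin⟩
  rw [mem_waringLocus_iff hd, Set.mem_union, Set.mem_singleton_iff]
  constructor
  · rintro ⟨L, hL, ℓ, hℓL, hℓ, rfl⟩
    obtain ⟨ζ, M, hζ, hM, rfl⟩ := (hmin L).1 hL
    rcases Multiset.mem_cons.1 hℓL with rfl | hℓM
    · exact Or.inl ((Projectivization.mk_eq_mk_iff' ℂ _ _ _ _).2 ⟨ζ, rfl⟩)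
    · obtain ⟨m, hm, rfl⟩ := Multiset.mem_map.1 hℓM
      have hm0 : m ≠ 0 := by
        rintro rfl
        exact hℓ (map_zero _)
      exact Or.inr ⟨_, (mem_waringLocus_iff hd).2 ⟨M, hM, m, hm, hm0, rfl⟩,
        Projectivization.map_mk _ _ _ _⟩
  · rintro (rfl | ⟨Q, hQ, rfl⟩)
    · exact ⟨_, (hmin _).2 ⟨1, M₀, one_pow d, hM₀, rfl⟩, varForm 0, by simp,
        varForm_ne_zero 0, rfl⟩
    · obtain ⟨M, hM, m, hm, hm0, rfl⟩ := (mem_waringLocus_iff hd).1 hQ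
      exact ⟨_, (hmin _).2 ⟨1, M, one_pow d, hM, rfl⟩, binaryIncl m,
        Multiset.mem_cons_of_mem (Multiset.mem_map_of_mem _ hm),
        fun h => hm0 (binaryIncl_injective (h.trans (map_zero _).symm)),
        Projectivization.map_mk _ _ _ _⟩
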